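/- For a polynomial $G$ in $m$ variables with integer coefficients put $V_G^*=\{\mathbf z\in\mathbb A^m_{\mathbb C}:\nabla G(\mathbf z)=\mathbf 0\}$, and for an affine variety $V\subseteq\mathbb A^m_{\mathbb C}$ put $\operatorname{codim}V=m-\dim V$. Let $F\in\mathbb Z[x_1,\dots,x_n]$ be a homogeneous form of degree $d\ge 2$ and let $\mathcal C_0=4(d-1)2^d+1$. For a partition of the variables $\mathbf x=(\mathbf z,\mathbf w)$ write $F_{\mathbf z}(\mathbf z)=F(\mathbf z,\mathbf 0)$. Suppose that for all partitions of variables $\mathbf x=(\mathbf z,\mathbf w)$ and $\mathbf z=(\mathbf s,\mathbf t)$ the form $$\mathfrak G(\mathbf s,\mathbf t)=F_{\mathbf z}(\mathbf s,\mathbf t)-F_{\mathbf z}(\mathbf s,\mathbf 0)-F_{\mathbf z}(\mathbf 0,\mathbf t),$$ a polynomial in the variables $\mathbf z$, satisfies $\operatorname{codim}V_{\mathfrak G}^*\le\mathcal C_0$. Let $\mathbf x=(\mathbf z,\mathbf w)$ be a partition of variables with $\mathbf z=(z_1,\dots,z_h)$, $h\ge 1$, let $\mathfrak F(\mathbf z)=F(\mathbf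 z,\mathbf 0)$, and define, for $\mathbf u=(u_1,\dots,u_h)$ and $\mathbf v=(v_1,\dots,v_h)$, the form $\mathcal G(\mathbf u;\mathbf v)=\mathfrak F(u_1v_1,\dots,u_hv_h)$. Let $$V_{\mathcal G,2}^*=\Big\{(\mathbf u,\mathbf v)\in\mathbb A^{2h}_{\mathbb C}:\ \frac{\partial\mathcal G}{\partial v_i}(\mathbf u;\mathbf v)=0\quad(1\le i\le h)\Big\}.$$ Then $$\operatorname{codim}V_{\mathcal G,2}^*\ \ge\ \operatorname{codim}V_{\mathfrak F}^*-\mathcal C_0 .$$ -/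

import Mathlib

open MvPolynomial

noncomputable section

namespace SemiprimeProp

/-- The dimension of an algebraic set `V ⊆ ℂ^τ`: the Krull dimension of its coordinate ring
`ℂ[τ] / I(V)`. For finite `τ` and nonempty `V` the Krull dimension is a natural number, so that
no default value intervenes (all the loci considered below contain the origin). -/
def affineDim {τ : Type*} (V : Set (τ → ℂ)) : ℕ :=
  ((ringKrullDim (MvPolynomial τ ℂ ⧸ vanishingIdeal ℂ V)).unbotD 0).toNat

/-- The codimension `m - dim V` of an algebraic set `V` in affine `m`-space, `m = #τ`. -/
def affineCodim {τ : Type*} [Fintype τ] (V : Set (τ → ℂ)) : ℤ :=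
  (Fintype.card τ : ℤ) - (affineDim V : ℤ)

/-- The affine variety `V_G^* = {z ∈ ℂ^τ : ∇G(z) = 0}`. -/
def singLocus {τ : Type*} (G : MvPolynomial τ ℤ) : Set (τ → ℂ) :=
  {z | ∀ i, aeval z (pderiv i G) = 0}

/-- The affine variety `V_{G,2}^*` of the points `(u, v)` at which all the partial derivatives of
`G(u; v)` with respect to the second set of variables vanish
(`Sum.inl i` is the variable `u_i`, `Sum.inr i` is the variable `v_i`). -/
def singLocusSnd {τ : Type*} (G : MvPolynomial (τ ⊕ τ) ℤ) : Set (τ ⊕ τ → ℂ) :=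
  {p | ∀ i : τ, aeval p (pderiv (Sum.inr i) G) = 0}

/-- For the partition `x = (z, w)` in which `z` consists of the variables with index in `Z`:
the form `F_z(z) = F(z, 0)`, a polynomial in the variables `z`. -/
def restrictTo {σ : Type*} [DecidableEq σ] (F : MvPolynomial σ ℤ) (Z : Finset σ) :
    MvPolynomial Z ℤ :=
  aeval (fun i : σ => if h : i ∈ Z then (X ⟨i, h⟩ : MvPolynomial Z ℤ) else 0) F

/-- Keep the variables with index in `S` and set the others equal to zero; the result is still
viewed as a polynomial in all the variables. -/
def keepOnly {τ : Type*} [DecidableEq τ] (S : Finset τ) (P : MvPolynomial τ ℤ) :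
    MvPolynomial τ ℤ :=
  aeval (fun i : τ => if i ∈ S then (X i : MvPolynomial τ ℤ) else 0) P

/-- For a partition `z = (s, t)`, where `s` consists of the variables with index in `S` and `t` of
the others: `𝔊(s, t) = P(s, t) - P(s, 0) - P(0, t)`. -/
def mixedPart {τ : Type*} [Fintype τ] [DecidableEq τ] (P : MvPolynomial τ ℤ) (S : Finset τ) :
    MvPolynomial τ ℤ :=
  P - keepOnly S P - keepOnly Sᶜ P

/-- Alternative (II) of the structural dichotomy with respect to `C`: for all partitions
`x = (z, w)` and `z = (s, t)` we have `codim V_𝔊^* ≤ C`, where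
`𝔊(s, t) = F_z(s, t) - F_z(s, 0) - F_z(0, t)`. -/
def SatisfiesII {n : ℕ} (F : MvPolynomial (Fin n) ℤ) (C : ℤ) : Prop :=
  ∀ (Z : Finset (Fin n)) (S : Finset Z),
    affineCodim (singLocus (mixedPart (restrictTo F Z) S)) ≤ C

/-- The form `𝒢(u; v) = P(u_1 v_1, …, u_h v_h)`. -/
def doubled {τ : Type*} (P : MvPolynomial τ ℤ) : MvPolynomial (τ ⊕ τ) ℤ :=
  aeval (fun i : τ => (X (Sum.inl i) * X (Sum.inr i) : MvPolynomial (τ ⊕ τ) ℤ)) P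

/-- The constant `𝒞₀ = 4 (d - 1) 2^d + 1`. -/
def C₀ (d : ℕ) : ℤ := 4 * ((d : ℤ) - 1) * 2 ^ d + 1

end SemiprimeProp

end

/-!
Write `P = F(z, 0)`. At a point `(u, v)` of `V_{𝒢,2}^*` the product `x = u v` satisfies
`x_i ∂_i P(x) = 0` for all `i`. Cutting with the `h` hyperplanes `u_i = v_i` lowers the dimension by
at most `h`, and on the diagonal `u = v` the map `(u, v) ↦ u v` is finite; hence
`dim V_{𝒢,2}^* ≤ h + dim {x | ∀ i, x_i ∂_i P(x) = 0}`.

Sorting the points `x` by the support `S` of their coordinates covers the right-hand set by the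
singular loci of the restrictions `P(s, 0)`. On such a locus `t = 0`, so there the gradients of `𝔊`
and `P` differ only by the gradients of `P(s, 0)`, in the variables `s`, and of `P(0, t)` at the
origin, and both vanish: the locus meets `V_𝔊^*` inside `V_P^*`. Since `codim V_𝔊^* ≤ C`, the affine
dimension theorem for cones bounds its dimension by `dim V_P^* + C`.

The dimension theorem is the usual reduction to the diagonal: Krull's height theorem at the vertex,
where all components of a cone meet, and going down for `A → A ⊗ B`, which makes the height of the
vertex additive.
-/

namespace SemiprimeProp

section KrullDim

open scoped TensorProduct

theorem ringKrullDim_le_of_isIntegral {A B : Type*} [CommRing A] [CommRing B] {f : A →+* B}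
    (hf : f.IsIntegral) : ringKrullDim B ≤ ringKrullDim A := by
  algebraize [f]
  exact Order.krullDim_le_of_strictMono (PrimeSpectrum.comap (algebraMap A B)) fun _ _ hpq =>
    Ideal.IsIntegral.comap_lt_comap hpq

theorem height_le_height_comap_of_surjective {A B : Type*} [CommRing A] [CommRing B]
    {f : A →+* B} (hf : Function.Surjective f) (Q : Ideal B) [Q.IsPrime] :
    Q.height ≤ (Q.comap f).height := by
  have h := Order.height_le_height_apply_of_strictMono (PrimeSpectrum.comap f)
    (RingHom.strictMono_comap_of_surjective hf) ⟨Q, inferInstance⟩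
  rwa [← PrimeSpectrum.height_eq_orderHeight, ← PrimeSpectrum.height_eq_orderHeight] at h

theorem ringKrullDim_quotient_le_of_forall_prime {A ι : Type*} [CommRing A] {I : Ideal A}
    {J : ι → Ideal A} {n : WithBot ℕ∞} (hIJ : ∀ P : Ideal A, P.IsPrime → I ≤ P → ∃ i, J i ≤ P)
    (hJ : ∀ i, ringKrullDim (A ⧸ J i) ≤ n) : ringKrullDim (A ⧸ I) ≤ n := by
  rw [ringKrullDim_quotient]
  refine iSup_le fun l => ?_
  obtain ⟨i, hi⟩ := hIJ l.head.1.asIdeal l.head.1.2 l.head.2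
  let L : LTSeries (PrimeSpectrum.zeroLocus (R := A) (J i)) :=
    { length := l.length
      toFun := fun k => ⟨(l k).1, fun _ hx => (l.head_le k : l.head.1.asIdeal ≤ _) (hi hx)⟩
      step := l.step }
  exact (Order.LTSeries.length_le_krullDim L).trans
    ((ringKrullDim_quotient (J i)).symm.trans_le (hJ i))

theorem height_eq_of_isMaximal_mvPolynomial {k : Type*} [Field k] :
    ∀ {n : ℕ} (m : Ideal (MvPolynomial (Fin n) k)) [m.IsMaximal], m.height = n
  | 0, m, hm => by
    have h := Ideal.height_le_ringKrullDim_of_ne_top hm.ne_top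
    rw [MvPolynomial.ringKrullDim_of_isNoetherianRing, ringKrullDim_eq_zero_of_field,
      Nat.card_fin, zero_add] at h
    exact nonpos_iff_eq_zero.1 (WithBot.coe_le_coe.1 h)
  | n + 1, m, hm => by
    let e : MvPolynomial (Fin (n + 1)) k ≃+* Polynomial (MvPolynomial (Fin n) k) :=
      (finSuccEquiv k n).toRingEquiv
    have hM : (m.comap e.symm).IsMaximal := Ideal.comap_isMaximal_of_equiv e.symm
    have hp := Polynomial.isMaximal_comap_C_of_isJacobsonRing (m.comap e.symm)
    have : (m.comap e.symm).LiesOver ((m.comap e.symm).comap Polynomial.C) := ⟨rfl⟩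
    rw [← RingEquiv.height_comap e.symm, Polynomial.height_eq_height_add_one
      ((m.comap e.symm).comap Polynomial.C), height_eq_of_isMaximal_mvPolynomial, Nat.cast_succ]

theorem height_eq_ringKrullDim_of_isMaximal (k : Type*) {A : Type*} [Field k] [CommRing A]
    [IsDomain A] [Algebra k A] [Algebra.FiniteType k A] (m : Ideal A) [m.IsMaximal] :
    (m.height : WithBot ℕ∞) = ringKrullDim A := by
  obtain ⟨s, g, hginj, hgint⟩ := exists_integral_inj_algHom_of_fg k A
  algebraize [g.toRingHom]
  have : FaithfulSMul (MvPolynomial (Fin s) k) A :=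
    (faithfulSMul_iff_algebraMap_injective _ _).2 hginj
  have : Algebra.IsIntegral (MvPolynomial (Fin s) k) A := ⟨hgint⟩
  have : IsNoetherianRing A := Algebra.FiniteType.isNoetherianRing k A
  have : (m.under (MvPolynomial (Fin s) k)).IsMaximal := inferInstance
  refine (Ideal.height_le_ringKrullDim_of_ne_top Ideal.IsPrime.ne_top').antisymm ?_
  calc ringKrullDim A ≤ ringKrullDim (MvPolynomial (Fin s) k) := ringKrullDim_le_of_isIntegral hgint
    _ = s := by
      rw [MvPolynomial.ringKrullDim_of_isNoetherianRing, ringKrullDim_eq_zero_of_field,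
        Nat.card_fin, zero_add]
    _ = (m.under (MvPolynomial (Fin s) k)).height := by
      rw [height_eq_of_isMaximal_mvPolynomial]; rfl
    _ ≤ m.height := by
      rw [Ideal.height_eq_height_add_of_liesOver_of_hasGoingDown
        (m.under (MvPolynomial (Fin s) k)) m]
      exact_mod_cast le_self_add

theorem ringKrullDim_quotient_le_height_map (k : Type*) {A : Type*} [Field k] [CommRing A]
    [Algebra k A] [Algebra.FiniteType k A] {I m : Ideal A} [m.IsMaximal]
    (hI : ∀ p ∈ I.minimalPrimes, p ≤ m) :
    ringKrullDim (A ⧸ I) ≤ (m.map (Ideal.Quotient.mk I)).height := by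
  refine ringKrullDim_quotient_le_of_forall_prime (J := fun p : I.minimalPrimes => p.1)
    (fun P _ hIP => ?_) fun ⟨p, hp⟩ => ?_
  · obtain ⟨p, hp, hpP⟩ := Ideal.exists_minimalPrimes_le hIP
    exact ⟨⟨p, hp⟩, hpP⟩
  · have := hp.1.1
    have : (m.map (Ideal.Quotient.mk p)).IsMaximal :=
      .map_of_surjective_of_ker_le Ideal.Quotient.mk_surjective (Ideal.mk_ker.trans_le (hI p hp))
    have hsurj := Ideal.Quotient.factor_surjective hp.1.2
    have hcomap : (m.map (Ideal.Quotient.mk p)).comap (Ideal.Quotient.factor hp.1.2) =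
        m.map (Ideal.Quotient.mk I) := by
      refine Ideal.comap_injective_of_surjective _ Ideal.Quotient.mk_surjective ?_
      rw [Ideal.comap_comap, Ideal.Quotient.factor_comp_mk,
        Ideal.comap_map_mk (hI p hp), Ideal.comap_map_mk (hp.1.2.trans (hI p hp))]
    rw [← height_eq_ringKrullDim_of_isMaximal k (m.map (Ideal.Quotient.mk p)), ← hcomap]
    exact WithBot.coe_le_coe.2 (height_le_height_comap_of_surjective hsurj _)

theorem ringKrullDim_quotient_le_height_ker_liftₐ {k A : Type*} [Field k] [CommRing A] [Algebra k A]
    [Algebra.FiniteType k A] (ε : A →ₐ[k] k) {I : Ideal A} (hIε : I ≤ RingHom.ker ε)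
    (hI : ∀ p ∈ I.minimalPrimes, p ≤ RingHom.ker ε) :
    ringKrullDim (A ⧸ I) ≤ (RingHom.ker (Ideal.Quotient.liftₐ I ε hIε)).height := by
  have : (RingHom.ker ε).IsMaximal :=
    RingHom.ker_isMaximal_of_surjective ε fun c => ⟨algebraMap k A c, by simp⟩
  rw [show RingHom.ker (Ideal.Quotient.liftₐ I ε hIε) = (RingHom.ker ε).map (Ideal.Quotient.mk I)
    from Ideal.ker_quotient_lift ε.toRingHom hIε]
  exact ringKrullDim_quotient_le_height_map k hI

theorem height_add_height_le_height_comap {A T B : Type*} [CommRing A] [CommRing T] [CommRing B]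
    [IsNoetherianRing A] [IsNoetherianRing T] [Algebra A T] [Algebra.HasGoingDown A T]
    {f : T →+* B} (hf : Function.Surjective f) (p : Ideal A) [p.IsPrime] (Q : Ideal B) [Q.IsPrime]
    (hp : p ≤ RingHom.ker (f.comp (algebraMap A T))) [(Q.comap f).LiesOver p] :
    p.height + Q.height ≤ (Q.comap f).height := by
  have hker : p.map (algebraMap A T) ≤ RingHom.ker f := Ideal.map_le_iff_le_comap.2 hp
  let g : T ⧸ p.map (algebraMap A T) →+* B := Ideal.Quotient.lift _ f hker
  have hcomap : Q.comap g = (Q.comap f).map (Ideal.Quotient.mk (p.map (algebraMap A T))) := by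
    refine Ideal.comap_injective_of_surjective _ Ideal.Quotient.mk_surjective ?_
    rw [Ideal.comap_comap, show g.comp _ = f from Ideal.Quotient.lift_comp_mk _ f hker,
      Ideal.comap_map_mk (hker.trans (Ideal.comap_mono bot_le))]
  rw [Ideal.height_eq_height_add_of_liesOver_of_hasGoingDown p (Q.comap f), ← hcomap]
  gcongr
  exact height_le_height_comap_of_surjective (Ideal.Quotient.lift_surjective_of_surjective _ _ hf) Q

theorem height_ker_add_height_ker_le {k A B : Type*} [Field k] [CommRing A] [CommRing B]
    [Algebra k A] [Algebra k B] [IsNoetherianRing A] [IsNoetherianRing (A ⊗[k] B)]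
    (ε : A →ₐ[k] k) (η : B →ₐ[k] k) :
    (RingHom.ker ε).height + (RingHom.ker η).height ≤
      (RingHom.ker (Algebra.TensorProduct.lift ε η fun _ _ => .all _ _)).height := by
  let f : A ⊗[k] B →ₐ[k] B :=
    Algebra.TensorProduct.lift ((Algebra.ofId k B).comp ε) (.id k B) fun _ _ => .all _ _
  have hf : Function.Surjective f := fun b => ⟨1 ⊗ₜ b, by simp [f]⟩
  have hcomap : (RingHom.ker η).comap f.toRingHom =
      RingHom.ker (Algebra.TensorProduct.lift ε η fun _ _ => .all _ _) := by
    have : η.comp f = Algebra.TensorProduct.lift ε η fun _ _ => .all _ _ := by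
      ext <;> simp [f]
    rw [← this]
    rfl
  have : ((RingHom.ker η).comap f.toRingHom).LiesOver (RingHom.ker ε) := by
    refine ⟨?_⟩
    rw [hcomap]
    ext a
    simp [RingHom.mem_ker]
  have := RingHom.ker_isPrime ε
  have := RingHom.ker_isPrime η
  rw [← hcomap]
  refine height_add_height_le_height_comap hf _ _ fun a ha => ?_
  rw [RingHom.mem_ker] at ha
  simp [f, RingHom.mem_ker, ha]

theorem encard_range_le_natCard {ι α : Type*} [Finite ι] (f : ι → α) :
    (Set.range f).encard ≤ Nat.card ι :=
  (ENat.card_eq_coe_natCard (Set.range f)).trans_le (mod_cast Finite.card_range_le f)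

theorem ringKrullDim_quotient_le_sup_span_range_add_card (k : Type*) {A ι : Type*} [Field k]
    [CommRing A] [Algebra k A] [Algebra.FiniteType k A] [Finite ι] {I m : Ideal A} [m.IsMaximal]
    (hIm : I ≤ m) (hI : ∀ p ∈ I.minimalPrimes, p ≤ m) {f : ι → A} (hf : ∀ i, f i ∈ m) :
    ringKrullDim (A ⧸ I) ≤ ringKrullDim (A ⧸ (I ⊔ Ideal.span (Set.range f))) + Nat.card ι := by
  have : IsNoetherianRing A := Algebra.FiniteType.isNoetherianRing k A
  have : (m.map (Ideal.Quotient.mk I)).IsMaximal :=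
    .map_of_surjective_of_ker_le Ideal.Quotient.mk_surjective (by rwa [Ideal.mk_ker])
  let g : ι → A ⧸ I := fun i => Ideal.Quotient.mk I (f i)
  have hg : Set.range g ⊆ m.map (Ideal.Quotient.mk I) :=
    Set.range_subset_iff.2 fun i => Ideal.mem_map_of_mem _ (hf i)
  have hspan : Ideal.span (Set.range g) = (Ideal.span (Set.range f)).map (Ideal.Quotient.mk I) := by
    rw [Ideal.map_span, ← Set.range_comp]
    rfl
  calc ringKrullDim (A ⧸ I) ≤ (m.map (Ideal.Quotient.mk I)).height :=
        ringKrullDim_quotient_le_height_map k hI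
    _ ≤ ringKrullDim ((A ⧸ I) ⧸ Ideal.span (Set.range g)) + (Set.range g).encard :=
        Ideal.height_le_ringKrullDim_quotient_add_encard _ hg
    _ ≤ ringKrullDim (A ⧸ (I ⊔ Ideal.span (Set.range f))) + Nat.card ι := by
      rw [hspan, ringKrullDim_eq_of_ringEquiv (DoubleQuot.quotQuotEquivQuotSup _ _)]
      gcongr
      exact WithBot.coe_le_coe.2 (encard_range_le_natCard g)

theorem ringKrullDim_quotient_diagonal_le {k S ι : Type*} [Field k] [CommRing S] [Algebra k S]
    {x : ι → S} (hx : Algebra.adjoin k (Set.range x) = ⊤) (I J : Ideal S) :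
    ringKrullDim (((S ⧸ I) ⊗[k] (S ⧸ J)) ⧸ Ideal.span (Set.range fun i =>
      Ideal.Quotient.mk I (x i) ⊗ₜ[k] 1 - 1 ⊗ₜ[k] Ideal.Quotient.mk J (x i))) ≤
    ringKrullDim (S ⧸ (I ⊔ J)) := by
  set Δ := Ideal.span (Set.range fun i =>
    Ideal.Quotient.mk I (x i) ⊗ₜ[k] 1 - 1 ⊗ₜ[k] Ideal.Quotient.mk J (x i))
  let φ : S →ₐ[k] ((S ⧸ I) ⊗[k] (S ⧸ J)) ⧸ Δ := (Ideal.Quotient.mkₐ k Δ).comp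
    (Algebra.TensorProduct.includeLeft.comp (Ideal.Quotient.mkₐ k I))
  let ψ : S →ₐ[k] ((S ⧸ I) ⊗[k] (S ⧸ J)) ⧸ Δ := (Ideal.Quotient.mkₐ k Δ).comp
    (Algebra.TensorProduct.includeRight.comp (Ideal.Quotient.mkₐ k J))
  have hφψ : φ = ψ := by
    refine AlgHom.ext_of_adjoin_eq_top hx ?_
    rintro _ ⟨i, rfl⟩
    exact Ideal.Quotient.eq.2 (Ideal.subset_span ⟨i, rfl⟩)
  have hker : I ⊔ J ≤ RingHom.ker φ := by
    refine sup_le (fun f hf => ?_) fun f hf => ?_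
    · simp [φ, RingHom.mem_ker, Ideal.Quotient.eq_zero_iff_mem.2 hf]
    · simp [hφψ, ψ, RingHom.mem_ker, Ideal.Quotient.eq_zero_iff_mem.2 hf]
  have hsurj : Function.Surjective φ := by
    rw [← AlgHom.range_eq_top, eq_top_iff]
    rintro t -
    obtain ⟨t, rfl⟩ := Ideal.Quotient.mk_surjective t
    induction t with
    | zero => exact zero_mem _
    | add t t' ht ht' => exact add_mem ht ht'
    | tmul a b =>
      obtain ⟨f, rfl⟩ := Ideal.Quotient.mk_surjective a
      obtain ⟨g, rfl⟩ := Ideal.Quotient.mk_surjective b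
      refine ⟨f * g, ?_⟩
      calc φ (f * g) = φ f * ψ g := by rw [map_mul, ← hφψ]
        _ = _ := by simp [φ, ψ, ← map_mul]
  exact ringKrullDim_le_of_surjective (Ideal.Quotient.lift (I ⊔ J) φ.toRingHom hker)
    (Ideal.Quotient.lift_surjective_of_surjective _ _ hsurj)

theorem ringKrullDim_quotient_add_le {k S ι : Type*} [Field k] [CommRing S] [Algebra k S]
    [Finite ι] {x : ι → S} (hx : Algebra.adjoin k (Set.range x) = ⊤) (ε : S →ₐ[k] k)
    {I J : Ideal S} (hIε : I ≤ RingHom.ker ε) (hJε : J ≤ RingHom.ker ε)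
    (hI : ∀ p ∈ I.minimalPrimes, p ≤ RingHom.ker ε)
    (hJ : ∀ p ∈ J.minimalPrimes, p ≤ RingHom.ker ε) :
    ringKrullDim (S ⧸ I) + ringKrullDim (S ⧸ J) ≤ ringKrullDim (S ⧸ (I ⊔ J)) + Nat.card ι := by
  have : Algebra.FiniteType k S := ⟨Subalgebra.fg_def.2 ⟨_, Set.finite_range x, hx⟩⟩
  let M := RingHom.ker (Algebra.TensorProduct.lift
    (Ideal.Quotient.liftₐ I ε hIε) (Ideal.Quotient.liftₐ J ε hJε) fun _ _ => .all _ _)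
  have : M.IsPrime := RingHom.ker_isPrime _
  let δ : ι → (S ⧸ I) ⊗[k] (S ⧸ J) :=
    fun i => Ideal.Quotient.mk I (x i) ⊗ₜ 1 - 1 ⊗ₜ Ideal.Quotient.mk J (x i)
  have hδ : Set.range δ ⊆ M := by
    rintro _ ⟨i, rfl⟩
    have hI : Ideal.Quotient.liftₐ I ε hIε (Ideal.Quotient.mk I (x i)) = ε (x i) := rfl
    have hJ : Ideal.Quotient.liftₐ J ε hJε (Ideal.Quotient.mk J (x i)) = ε (x i) := rfl
    simp [M, δ, RingHom.mem_ker, hI, hJ]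
  have : IsNoetherianRing (S ⧸ I) := Algebra.FiniteType.isNoetherianRing k _
  have : IsNoetherianRing ((S ⧸ I) ⊗[k] (S ⧸ J)) := Algebra.FiniteType.isNoetherianRing (S ⧸ I) _
  calc ringKrullDim (S ⧸ I) + ringKrullDim (S ⧸ J)
      ≤ (RingHom.ker (Ideal.Quotient.liftₐ I ε hIε)).height +
        (RingHom.ker (Ideal.Quotient.liftₐ J ε hJε)).height :=
        add_le_add (ringKrullDim_quotient_le_height_ker_liftₐ ε hIε hI)
          (ringKrullDim_quotient_le_height_ker_liftₐ ε hJε hJ)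
    _ ≤ (M.height : WithBot ℕ∞) := mod_cast height_ker_add_height_ker_le _ _
    _ ≤ ringKrullDim (((S ⧸ I) ⊗[k] (S ⧸ J)) ⧸ Ideal.span (Set.range δ)) +
        (Set.range δ).encard := Ideal.height_le_ringKrullDim_quotient_add_encard _ hδ
    _ ≤ ringKrullDim (S ⧸ (I ⊔ J)) + Nat.card ι :=
        add_le_add (ringKrullDim_quotient_diagonal_le hx I J)
          (WithBot.coe_le_coe.2 (encard_range_le_natCard δ))

end KrullDim

section Homogeneous

theorem isHomogeneous_of_mem_minimalPrimes {ι A ς : Type*} [AddCommMonoid ι] [LinearOrder ι]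
    [IsOrderedCancelAddMonoid ι] [CommRing A] [SetLike ς A] [AddSubmonoidClass ς A] {𝒜 : ι → ς}
    [GradedRing 𝒜] {I p : Ideal A} (hI : I.IsHomogeneous 𝒜) (hp : p ∈ I.minimalPrimes) :
    p.IsHomogeneous 𝒜 := by
  have hcore : I ≤ (p.homogeneousCore 𝒜).toIdeal := by
    rw [← hI.toIdeal_homogeneousCore_eq_self]
    exact Ideal.homogeneousCore_mono 𝒜 hp.1.2
  have hprime := hp.1.1.homogeneousCore (𝒜 := 𝒜)
  have heq := (Ideal.toIdeal_homogeneousCore_le 𝒜 p).antisymm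
    (hp.2 ⟨hprime, hcore⟩ (Ideal.toIdeal_homogeneousCore_le 𝒜 p))
  exact heq ▸ (p.homogeneousCore 𝒜).isHomogeneous

attribute [local instance] MvPolynomial.gradedAlgebra

theorem le_ker_aeval_zero_of_isHomogeneous {k σ : Type*} [Field k] {I : Ideal (MvPolynomial σ k)}
    (hI : I.IsHomogeneous (homogeneousSubmodule σ k)) (hne : I ≠ ⊤) :
    I ≤ RingHom.ker (aeval (0 : σ → k)) := by
  intro f hf
  have hC : C (coeff 0 f) ∈ I :=
    homogeneousComponent_zero f ▸ homogeneousComponent_mem_of_mem hI hf 0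
  by_contra h0
  refine hne (I.eq_top_of_isUnit_mem hC ((IsUnit.mk0 _ fun h => h0 ?_).map C))
  simpa [RingHom.mem_ker, constantCoeff_eq] using h

theorem le_ker_aeval_zero_of_mem_minimalPrimes {k σ : Type*} [Field k]
    {I p : Ideal (MvPolynomial σ k)}
    (hI : I.IsHomogeneous (homogeneousSubmodule σ k)) (hp : p ∈ I.minimalPrimes) :
    p ≤ RingHom.ker (aeval (0 : σ → k)) :=
  le_ker_aeval_zero_of_isHomogeneous (isHomogeneous_of_mem_minimalPrimes hI hp) hp.1.1.ne_top

end Homogeneous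

section Cone

variable {σ τ ι : Type*}

theorem ringKrullDim_eq_affineDim [Finite τ] {V : Set (τ → ℂ)} (hV : V.Nonempty) :
    ringKrullDim (MvPolynomial τ ℂ ⧸ vanishingIdeal ℂ V) = affineDim V := by
  have hle : ringKrullDim (MvPolynomial τ ℂ ⧸ vanishingIdeal ℂ V) ≤ (Nat.card τ : ℕ) := by
    refine (ringKrullDim_quotient_le _).trans ?_
    rw [MvPolynomial.ringKrullDim_of_isNoetherianRing, ringKrullDim_eq_zero_of_field, zero_add]
  have : Nontrivial (MvPolynomial τ ℂ ⧸ vanishingIdeal ℂ V) := by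
    rw [Ideal.Quotient.nontrivial_iff, Ideal.ne_top_iff_one]
    obtain ⟨x, hx⟩ := hV
    exact fun h => one_ne_zero ((map_one (aeval (R := ℂ) x)).symm.trans (h x hx))
  have hnonneg := ringKrullDim_nonneg_of_nontrivial (R := MvPolynomial τ ℂ ⧸ vanishingIdeal ℂ V)
  unfold affineDim
  generalize ringKrullDim (MvPolynomial τ ℂ ⧸ vanishingIdeal ℂ V) = d at hnonneg hle
  cases d with
  | bot => simp at hnonneg
  | coe d =>
    cases d with
    | top => exact absurd (WithBot.coe_le_coe.1 hle) (by simp)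
    | coe d => rfl

theorem affineDim_le_iff [Finite τ] {V : Set (τ → ℂ)} {r : ℕ} :
    affineDim V ≤ r ↔ ringKrullDim (MvPolynomial τ ℂ ⧸ vanishingIdeal ℂ V) ≤ r := by
  rcases V.eq_empty_or_nonempty with rfl | hV
  · have : Subsingleton (MvPolynomial τ ℂ ⧸ vanishingIdeal ℂ (∅ : Set (τ → ℂ))) :=
      Ideal.Quotient.subsingleton_iff.2 vanishingIdeal_empty
    simp [affineDim, ringKrullDim_eq_bot_of_subsingleton]
  · rw [ringKrullDim_eq_affineDim hV, Nat.cast_le]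

theorem ringKrullDim_quotient_eq_affineDim_zeroLocus [Finite τ] {I : Ideal (MvPolynomial τ ℂ)}
    (hI : (zeroLocus ℂ I).Nonempty) :
    ringKrullDim (MvPolynomial τ ℂ ⧸ I) = affineDim (zeroLocus ℂ I) := by
  rw [← ringKrullDim_eq_affineDim hI, vanishingIdeal_zeroLocus_eq_radical, ringKrullDim_quotient,
    ringKrullDim_quotient, PrimeSpectrum.zeroLocus_radical]

theorem affineDim_le_of_subset_iUnion [Finite τ] [Finite ι] {U : Set (τ → ℂ)}
    {V : ι → Set (τ → ℂ)} (hUV : U ⊆ ⋃ i, V i) {r : ℕ} (hV : ∀ i, affineDim (V i) ≤ r) :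
    affineDim U ≤ r := by
  have := Fintype.ofFinite ι
  refine affineDim_le_iff.2 (ringKrullDim_quotient_le_of_forall_prime
    (J := fun i => vanishingIdeal ℂ (V i)) (fun P hP hUP => ?_) fun i => affineDim_le_iff.1 (hV i))
  have hle : Finset.univ.inf (fun i => vanishingIdeal ℂ (V i)) ≤ P := by
    refine le_trans (b := vanishingIdeal ℂ U) (fun p hp x hx => ?_) hUP
    obtain ⟨i, hi⟩ := Set.mem_iUnion.1 (hUV hx)
    exact (Finset.inf_le (f := fun i => vanishingIdeal ℂ (V i)) (Finset.mem_univ i) hp) x hi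
  obtain ⟨i, -, hi⟩ := (Ideal.IsPrime.inf_le' hP).1 hle
  exact ⟨i, hi⟩

theorem affineDim_mono [Finite τ] {U V : Set (τ → ℂ)} (hUV : U ⊆ V) :
    affineDim U ≤ affineDim V :=
  affineDim_le_of_subset_iUnion (ι := Unit) (V := fun _ => V) (hUV.trans (Set.iUnion_const V).ge)
    fun _ => le_rfl

theorem affineDim_le_of_isIntegralElem [Finite σ] [Finite τ] {U : Set (σ → ℂ)} {V : Set (τ → ℂ)}
    {f : τ → MvPolynomial σ ℂ} (hf : ∀ x ∈ U, (fun i => aeval x (f i)) ∈ V)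
    (hint : ∀ j, ((Ideal.Quotient.mkₐ ℂ (vanishingIdeal ℂ U)).comp
      (aeval f)).toRingHom.IsIntegralElem (Ideal.Quotient.mk _ (X j))) :
    affineDim U ≤ affineDim V := by
  let ψ : MvPolynomial τ ℂ →ₐ[ℂ] MvPolynomial σ ℂ ⧸ vanishingIdeal ℂ U :=
    (Ideal.Quotient.mkₐ ℂ (vanishingIdeal ℂ U)).comp (aeval f)
  have hψ : ψ.toRingHom.IsIntegral := by
    intro a
    obtain ⟨p, rfl⟩ := Ideal.Quotient.mk_surjective a
    induction p using MvPolynomial.induction_on with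
    | C c =>
      have := ψ.toRingHom.isIntegralElem_map (x := C c)
      rwa [show ψ.toRingHom (C c) = Ideal.Quotient.mk _ (aeval f (C c)) from rfl, aeval_C] at this
    | add p q hp hq => rw [map_add]; exact hp.add _ hq
    | mul_X p j hp => rw [map_mul]; exact hp.mul _ (hint j)
  have hker : ∀ p ∈ vanishingIdeal ℂ V, ψ p = 0 := by
    refine fun p hp => Ideal.Quotient.eq_zero_iff_mem.2 fun x hx => ?_
    exact (comp_aeval_apply f (aeval x) p).trans (hp _ (hf x hx))
  refine affineDim_le_iff.2 ((ringKrullDim_le_of_isIntegral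
    (f := Ideal.Quotient.lift _ ψ.toRingHom hker) ?_).trans (affineDim_le_iff.1 le_rfl))
  exact RingHom.IsIntegral.tower_top (Ideal.Quotient.mk _) _ hψ

theorem zeroLocus_sup {k K : Type*} [Field k] [Field K] [Algebra k K]
    (I J : Ideal (MvPolynomial τ k)) : zeroLocus K (I ⊔ J) = zeroLocus K I ∩ zeroLocus K J :=
  zeroLocus_vanishingIdeal_galoisConnection.l_sup

attribute [local instance] MvPolynomial.gradedAlgebra

/-- A closed cone in affine space: a set containing the origin that is the zero locus of a
homogeneous ideal. -/
def IsClosedCone (V : Set (τ → ℂ)) : Prop :=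
  0 ∈ V ∧ ∃ I : Ideal (MvPolynomial τ ℂ),
    I.IsHomogeneous (homogeneousSubmodule τ ℂ) ∧ V = zeroLocus ℂ I

theorem isClosedCone_of_isHomogeneous {f : ι → MvPolynomial τ ℤ} {n : ι → ℕ} (hn : ∀ i, n i ≠ 0)
    (hf : ∀ i, (f i).IsHomogeneous (n i)) : IsClosedCone {x : τ → ℂ | ∀ i, aeval x (f i) = 0} := by
  refine ⟨fun i => ?_, Ideal.span (Set.range fun i => map (algebraMap ℤ ℂ) (f i)),
    Ideal.homogeneous_span _ _ ?_, ?_⟩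
  · rw [aeval_zero, constantCoeff_eq, (hf i).coeff_eq_zero (by simpa using (hn i).symm), map_zero]
  · rintro _ ⟨i, rfl⟩
    exact ⟨n i, (hf i).map _⟩
  · ext x
    simp only [zeroLocus_span, Set.mem_ofPred_eq, Set.forall_mem_range, aeval_map_algebraMap]

theorem IsClosedCone.affineDim_add_le_inter [Finite τ] {V W : Set (τ → ℂ)} (hV : IsClosedCone V)
    (hW : IsClosedCone W) : affineDim V + affineDim W ≤ affineDim (V ∩ W) + Nat.card τ := by
  obtain ⟨hV0, I, hI, rfl⟩ := hV
  obtain ⟨hW0, J, hJ, rfl⟩ := hW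
  have hVW0 : (0 : τ → ℂ) ∈ zeroLocus ℂ (I ⊔ J) := by
    rw [zeroLocus_sup]
    exact ⟨hV0, hW0⟩
  have hdim := ringKrullDim_quotient_add_le (adjoin_range_X (R := ℂ) (σ := τ)) (aeval (0 : τ → ℂ))
    (fun f hf => hV0 f hf) (fun f hf => hW0 f hf)
    (fun p => le_ker_aeval_zero_of_mem_minimalPrimes hI)
    fun p => le_ker_aeval_zero_of_mem_minimalPrimes hJ
  rw [ringKrullDim_quotient_eq_affineDim_zeroLocus ⟨0, hV0⟩,
    ringKrullDim_quotient_eq_affineDim_zeroLocus ⟨0, hW0⟩,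
    ringKrullDim_quotient_eq_affineDim_zeroLocus ⟨0, hVW0⟩, zeroLocus_sup] at hdim
  exact_mod_cast hdim

theorem IsClosedCone.affineDim_le_inter_add_card [Finite τ] [Finite ι] {V : Set (τ → ℂ)}
    (hV : IsClosedCone V) {f : ι → MvPolynomial τ ℂ} (hf : ∀ j, aeval (0 : τ → ℂ) (f j) = 0) :
    affineDim V ≤ affineDim (V ∩ {x | ∀ j, aeval x (f j) = 0}) + Nat.card ι := by
  obtain ⟨hV0, I, hI, rfl⟩ := hV
  have : (RingHom.ker (aeval (R := ℂ) (0 : τ → ℂ))).IsMaximal :=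
    RingHom.ker_isMaximal_of_surjective _ fun c => ⟨C c, by simp⟩
  have hdim := ringKrullDim_quotient_le_sup_span_range_add_card ℂ (fun p hp => hV0 p hp)
    (fun p => le_ker_aeval_zero_of_mem_minimalPrimes hI) hf
  have hset : zeroLocus ℂ (I ⊔ Ideal.span (Set.range f)) =
      zeroLocus ℂ I ∩ {x | ∀ j, aeval x (f j) = 0} := by
    rw [zeroLocus_sup, zeroLocus_span]
    simp only [Set.forall_mem_range]
  rw [ringKrullDim_quotient_eq_affineDim_zeroLocus ⟨0, hV0⟩,
    ringKrullDim_quotient_eq_affineDim_zeroLocus ⟨0, hset ▸ ⟨hV0, hf⟩⟩, hset] at hdim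
  exact_mod_cast hdim

end Cone

section Loci

variable {τ : Type*}

theorem isHomogeneous_restrictTo {σ : Type*} [DecidableEq σ] {F : MvPolynomial σ ℤ} {d : ℕ}
    (hF : F.IsHomogeneous d) (Z : Finset σ) : (restrictTo F Z).IsHomogeneous d := by
  rw [← one_mul d]
  refine hF.aeval _ fun i => ?_
  split_ifs
  · exact isHomogeneous_X _ _
  · exact isHomogeneous_zero _ _ _

theorem isHomogeneous_keepOnly [DecidableEq τ] {P : MvPolynomial τ ℤ} {d : ℕ}
    (hP : P.IsHomogeneous d) (S : Finset τ) : (keepOnly S P).IsHomogeneous d := by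
  rw [← one_mul d]
  refine hP.aeval _ fun i => ?_
  split_ifs
  · exact isHomogeneous_X _ _
  · exact isHomogeneous_zero _ _ _

theorem isHomogeneous_mixedPart [Fintype τ] [DecidableEq τ] {P : MvPolynomial τ ℤ} {d : ℕ}
    (hP : P.IsHomogeneous d) (S : Finset τ) : (mixedPart P S).IsHomogeneous d :=
  (hP.sub (isHomogeneous_keepOnly hP S)).sub (isHomogeneous_keepOnly hP Sᶜ)

theorem isHomogeneous_doubled {P : MvPolynomial τ ℤ} {d : ℕ} (hP : P.IsHomogeneous d) :
    (doubled P).IsHomogeneous (2 * d) :=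
  hP.aeval _ fun _ => (isHomogeneous_X _ _).mul (isHomogeneous_X _ _)

theorem derivation_map_aeval {R A M : Type*} [CommSemiring R] [CommSemiring A] [Algebra R A]
    [AddCommMonoid M] [Module A M] [Module R M] [Fintype τ] (D : Derivation R A M) (f : τ → A)
    (P : MvPolynomial τ R) : D (aeval f P) = ∑ i, aeval f (pderiv i P) • D (f i) := by
  classical
  induction P using MvPolynomial.induction_on with
  | C a => simp
  | add p q hp hq => simp only [map_add, hp, hq, add_smul, Finset.sum_add_distrib]
  | mul_X p j hp =>
    simp only [map_mul, aeval_X, Derivation.leibniz, hp, pderiv_X, Pi.single_apply, smul_eq_mul,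
      map_add, add_smul, Finset.sum_add_distrib, Finset.smul_sum, mul_smul, mul_ite, mul_one,
      mul_zero, apply_ite (aeval f), map_zero, ite_smul, zero_smul, Finset.sum_ite_eq,
      Finset.mem_univ, if_true]

theorem pderiv_keepOnly [Finite τ] [DecidableEq τ] (S : Finset τ) (P : MvPolynomial τ ℤ) (i : τ) :
    pderiv i (keepOnly S P) = if i ∈ S then keepOnly S (pderiv i P) else 0 := by
  have := Fintype.ofFinite τ
  rw [keepOnly, derivation_map_aeval, Finset.sum_eq_single i]
  · split_ifs <;> simp [keepOnly]
  · intro j _ hji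
    split_ifs <;> simp [pderiv_X_of_ne hji]
  · simp

theorem pderiv_inr_doubled [Finite τ] (P : MvPolynomial τ ℤ) (i : τ) :
    pderiv (Sum.inr i) (doubled P) = X (Sum.inl i) * doubled (pderiv i P) := by
  have := Fintype.ofFinite τ
  rw [doubled, derivation_map_aeval, Finset.sum_eq_single i]
  · simp [doubled, mul_comm, pderiv_X_of_ne]
  · intro j _ hji
    simp [pderiv_X_of_ne, hji]
  · simp

theorem aeval_doubled (P : MvPolynomial τ ℤ) (p : τ ⊕ τ → ℂ) :
    aeval p (doubled P) = aeval (fun i => p (Sum.inl i) * p (Sum.inr i)) P :=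
  (comp_aeval_apply _ (aeval p) P).trans (by simp only [map_mul, aeval_X])

theorem aeval_keepOnly [DecidableEq τ] (S : Finset τ) (P : MvPolynomial τ ℤ) (x : τ → ℂ) :
    aeval x (keepOnly S P) = aeval (fun i => if i ∈ S then x i else 0) P :=
  (comp_aeval_apply _ (aeval x) P).trans (by simp only [apply_ite (aeval x), aeval_X, map_zero])

theorem isClosedCone_singLocus {P : MvPolynomial τ ℤ} {d : ℕ} (hd : 2 ≤ d)
    (hP : P.IsHomogeneous d) : IsClosedCone (singLocus P) :=
  isClosedCone_of_isHomogeneous (n := fun _ => d - 1) (fun _ => by omega) fun _ => hP.pderiv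

theorem isClosedCone_singLocusSnd {P : MvPolynomial (τ ⊕ τ) ℤ} {d : ℕ} (hd : 2 ≤ d)
    (hP : P.IsHomogeneous d) : IsClosedCone (singLocusSnd P) :=
  isClosedCone_of_isHomogeneous (n := fun _ => d - 1) (fun _ => by omega) fun _ => hP.pderiv

/-- The singular locus of the restriction of `P` to the coordinate subspace spanned by `S`, as a
subset of the ambient space. -/
def coordSingLocus [DecidableEq τ] (P : MvPolynomial τ ℤ) (S : Finset τ) : Set (τ → ℂ) :=
  {x | ∀ i, aeval x (if i ∈ S then pderiv i P else X i) = 0}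

/-- The logarithmic singular locus of `P`, cut out by the logarithmic derivatives `x_i ∂P/∂x_i`. -/
def logSingLocus (P : MvPolynomial τ ℤ) : Set (τ → ℂ) :=
  {x | ∀ i, aeval x (X i * pderiv i P) = 0}

theorem isClosedCone_coordSingLocus [DecidableEq τ] {P : MvPolynomial τ ℤ} {d : ℕ} (hd : 2 ≤ d)
    (hP : P.IsHomogeneous d) (S : Finset τ) : IsClosedCone (coordSingLocus P S) := by
  refine isClosedCone_of_isHomogeneous (n := fun i => if i ∈ S then d - 1 else 1) (fun i => ?_)
    fun i => ?_ <;> split_ifs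
  · omega
  · omega
  · exact hP.pderiv
  · exact isHomogeneous_X _ _

theorem logSingLocus_subset_iUnion_coordSingLocus [Finite τ] [DecidableEq τ]
    (P : MvPolynomial τ ℤ) : logSingLocus P ⊆ ⋃ S, coordSingLocus P S := by
  intro x hx
  refine Set.mem_iUnion.2 ⟨(Set.toFinite {i | x i ≠ 0}).toFinset, fun i => ?_⟩
  have hxi : x i * aeval x (pderiv i P) = 0 := by simpa using hx i
  by_cases hi : x i = 0
  · simp [hi]
  · simpa [hi] using hxi

theorem coordSingLocus_inter_singLocus_mixedPart_subset [Fintype τ] [DecidableEq τ]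
    {P : MvPolynomial τ ℤ} {d : ℕ} (hd : 2 ≤ d) (hP : P.IsHomogeneous d) (S : Finset τ) :
    coordSingLocus P S ∩ singLocus (mixedPart P S) ⊆ singLocus P := by
  rintro x ⟨hx, hxG⟩ i
  by_cases hi : i ∈ S
  · simpa only [if_pos hi] using hx i
  · have hxS : (fun j => if j ∈ Sᶜ then x j else 0) = 0 := by
      ext j
      by_cases hj : j ∈ S
      · simp [hj]
      · simpa [hj] using hx j
    have hPS : aeval x (keepOnly Sᶜ (pderiv i P)) = 0 := by
      rw [aeval_keepOnly, hxS]
      exact (isClosedCone_singLocus hd hP).1 i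
    simpa [mixedPart, pderiv_keepOnly, hi, hPS] using hxG i

theorem affineDim_logSingLocus_le [Fintype τ] [DecidableEq τ] {P : MvPolynomial τ ℤ} {d : ℕ}
    (hd : 2 ≤ d) (hP : P.IsHomogeneous d) {C : ℤ}
    (hC : ∀ S, affineCodim (singLocus (mixedPart P S)) ≤ C) :
    (affineDim (logSingLocus P) : ℤ) ≤ affineDim (singLocus P) + C := by
  have hcoord : ∀ S, (affineDim (coordSingLocus P S) : ℤ) ≤ affineDim (singLocus P) + C := by
    intro S
    have hinter := (isClosedCone_coordSingLocus hd hP S).affineDim_add_le_inter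
      (isClosedCone_singLocus hd (isHomogeneous_mixedPart hP S))
    have hsub := affineDim_mono (coordSingLocus_inter_singLocus_mixedPart_subset hd hP S)
    have hcodim := hC S
    rw [affineCodim] at hcodim
    rw [Nat.card_eq_fintype_card] at hinter
    omega
  obtain ⟨r, hr⟩ := Int.eq_ofNat_of_zero_le ((Int.natCast_nonneg _).trans (hcoord ∅))
  rw [hr]
  exact_mod_cast affineDim_le_of_subset_iUnion (logSingLocus_subset_iUnion_coordSingLocus P)
    fun S => Int.ofNat_le.1 (hr ▸ hcoord S)

theorem affineDim_le_of_diagonal [Finite τ] {U : Set (τ ⊕ τ → ℂ)} {V : Set (τ → ℂ)}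
    (hdiag : ∀ p ∈ U, ∀ i, p (Sum.inl i) = p (Sum.inr i))
    (hUV : ∀ p ∈ U, (fun i => p (Sum.inl i) * p (Sum.inr i)) ∈ V) : affineDim U ≤ affineDim V := by
  refine affineDim_le_of_isIntegralElem (f := fun i => X (Sum.inl i) * X (Sum.inr i))
    (fun p hp => by simpa only [map_mul, aeval_X] using hUV p hp) fun j => ?_
  -- On the diagonal each coordinate is a square root of a coordinate of the image.
  refine ⟨Polynomial.X ^ 2 - Polynomial.C (X (j.elim id id)),
    Polynomial.monic_X_pow_sub_C _ two_ne_zero, ?_⟩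
  rw [Polynomial.eval₂_sub, Polynomial.eval₂_X_pow, Polynomial.eval₂_C, sub_eq_zero, ← map_pow]
  refine Ideal.Quotient.eq.2 fun p hp => ?_
  rcases j with i | i <;> simp [hdiag p hp i, sq]

theorem affineDim_singLocusSnd_doubled_le [Fintype τ] {P : MvPolynomial τ ℤ} {d : ℕ} (hd : 2 ≤ d)
    (hP : P.IsHomogeneous d) :
    affineDim (singLocusSnd (doubled P)) ≤ affineDim (logSingLocus P) + Fintype.card τ := by
  rw [← Nat.card_eq_fintype_card]
  refine ((isClosedCone_singLocusSnd (by omega)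
    (isHomogeneous_doubled hP)).affineDim_le_inter_add_card
    (f := fun i => X (Sum.inl i) - X (Sum.inr i)) (fun i => by simp)).trans ?_
  gcongr
  refine affineDim_le_of_diagonal (fun p hp i => ?_) fun p hp i => ?_
  · simpa [sub_eq_zero] using hp.2 i
  · have hpi := hp.1 i
    rw [pderiv_inr_doubled, map_mul, aeval_X, aeval_doubled] at hpi
    rw [map_mul, aeval_X, mul_right_comm, hpi, zero_mul]

theorem mainTheorem4_general [Fintype τ] [DecidableEq τ] {P : MvPolynomial τ ℤ} {d : ℕ}
    (hd : 2 ≤ d) (hP : P.IsHomogeneous d) {C : ℤ}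
    (hC : ∀ S, affineCodim (singLocus (mixedPart P S)) ≤ C) :
    affineCodim (singLocus P) - C ≤ affineCodim (singLocusSnd (doubled P)) := by
  have hlog := affineDim_logSingLocus_le hd hP hC
  have hdoubled := affineDim_singLocusSnd_doubled_le hd hP
  rw [affineCodim, affineCodim, Fintype.card_sum]
  omega

end Loci

end SemiprimeProp

theorem mainTheorem4 (n d : ℕ) (hd : 2 ≤ d) (F : MvPolynomial (Fin n) ℤ)
    (hF : F.IsHomogeneous d) (hII : SemiprimeProp.SatisfiesII F (SemiprimeProp.C₀ d))
    (Z : Finset (Fin n)) (hZ : 1 ≤ Z.card) :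
    SemiprimeProp.affineCodim (SemiprimeProp.singLocus (SemiprimeProp.restrictTo F Z))
        - SemiprimeProp.C₀ d ≤
      SemiprimeProp.affineCodim
        (SemiprimeProp.singLocusSnd (SemiprimeProp.doubled (SemiprimeProp.restrictTo F Z))) :=
  SemiprimeProp.mainTheorem4_general hd (SemiprimeProp.isHomogeneous_restrictTo hF Z) (hII Z)
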